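/- **Setting.** Let $A$ be a set of $n$ agents and $G$ a set of $n$ goods. A profile of dichotomous utilities is $u\in\{0,1\}^{A\times G}$; the utility of agent $k$ from an allocation $x$ is $u_k(x)=\sum_{j}u_{kj}x_{kj}$. Let $c\in\mathbb R_{\ge 0}^A$ be publicly known disagreement utilities. The instance $(u,c)$ is *feasible* if some fractional perfect matching $x$ satisfies $u_k(x)>c_k$ for all $k$. Let $H$ be the bipartite graph on $A\cup G$ with edges $\{(k,j):u_{kj}=1\}$. **Mechanism (1DLAD algorithm).** On reported utilities $u$ and disagreement utilities $c$ it outputs an allocation $x$, prices $p$ and price-offsets $q$: 1. If $H$ has a perfect matching, give each agent her partner under one such matching, and set $q_k=1/(1-c_k)$ for all $k$ and $p=0$. 2. Otherwise choose a minimum vertex cover $G_1\cup A_2$ of $H$ ($G_1\subseteq G$, $A_2\subseteq A$) with as few agents as possible; let $A_1=A\setminus A_2$, $G_2=G\setminus G_1$. Choose a maximum matching of $H[A_2,G_2]$ and give each agent of $A_2$ her partner; set $q_k=1/(1-c_k)$ for $k\in A_2$ and $p_j=0$ for $j\in G_2$. 3. Set $q_k=0$ for $k\in A_1$ and run FLOW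 on $H[A_1,G_1]$: starting with $\theta=1$, raise the common price $\theta$ of all remaining goods until some nonempty set $S$ of remaining goods becomes *tight*, i.e. $|S|\,\theta=\sum_{k\in N(S)}(1+c_k\theta)$, where $N(S)$ is the set of remaining neighbours of $S$. Take a maximal tight set $S$, freeze its prices at $\theta$, sell it completely along edges of $H$ to $N(S)$ so that each $k\in N(S)$ spends exactly $1+c_k\theta$, remove $S$ and $N(S)$, and continue from the current $\theta$ until all of $G_1$ is sold. Finally give goods of $G_2$ left unmatched in step 2 to the agents of $A_1$ so that each of them has exactly one unit in total. An *output* is any $(x,p,q)$ produced by carrying out all the steps with some way of making the choices. In particular the size constraint in the last step must be met: if FLOW sells more than one unit to some agent, that run produces no output. **Theorem.** Let $(u,c)$ be feasible, let $i\in A$, and let $u'$ be obtained from $u$ by replacing agent $i$'s true utility function $u_i$ by an arbitrary dichotomous report $u'_i\in\{0,1\}^G$. (a) If $x$ and $x'$ are allocations output by the mechanism on $(u,c)$ and on $(u',c)$, respectively, then $u_i(x)\ge u_i(x')$. (b) The same inequality $u_i(x)\ge u_i(x')$ holds whenever $x$ and $x'$ are optimal solutions, for $(u,c)$ and $(u',c)$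 respectively, of the 1DLAD (Nash bargaining) program of maximizing $\sum_{k\in A}\log(v_k-c_k)$ subject to $v_k=\sum_j u_{kj}x_{kj}$, $v_k>c_k$ and $\sum_j x_{kj}\le 1$ for all $k\in A$, $\sum_k x_{kj}\le 1$ for all $j\in G$, and $x\ge 0$. Thus no agent can raise her true utility by misreporting. -/

import Mathlib

/-! A one-sided matching market with agents `A`, goods `G`, utilities `u : A → G → ℝ` and
disagreement utilities `c : A → ℝ`.  An allocation is a matrix `x : A → G → ℝ`. -/

noncomputable section

namespace OneDLAD

variable {A G : Type*}

/-- A utility function over goods with values in `{0, 1}`. -/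
def Dichotomous (w : G → ℝ) : Prop := ∀ j, w j = 0 ∨ w j = 1

/-- The utility that utility function `w` assigns to the bundle `b`. -/
def utility [Fintype G] (w b : G → ℝ) : ℝ := ∑ j, w j * b j

/-- Fractional perfect matchings: every agent gets one unit, every good is fully allocated. -/
structure IsFractionalPerfectMatching [Fintype A] [Fintype G] (x : A → G → ℝ) : Prop where
  nonneg : ∀ i j, 0 ≤ x i j
  row : ∀ i, ∑ j, x i j = 1
  col : ∀ j, ∑ i, x i j = 1

/-- Some fractional perfect matching gives every agent strictly more than her disagreement
utility. -/
def IsFeasible [Fintype A] [Fintype G] (u : A → G → ℝ) (c : A → ℝ) : Prop :=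
  ∃ x : A → G → ℝ, IsFractionalPerfectMatching x ∧ ∀ i, c i < utility (u i) (x i)

/-! ### The Nash bargaining program -/

/-- The points of the feasible region of the Nash bargaining program at which the objective
`∑ i, log (v i - c i)` is finite. -/
structure IsProgramPoint [Fintype A] [Fintype G] (u : A → G → ℝ) (c : A → ℝ)
    (x : A → G → ℝ) : Prop where
  nonneg : ∀ i j, 0 ≤ x i j
  row : ∀ i, ∑ j, x i j ≤ 1
  col : ∀ j, ∑ i, x i j ≤ 1
  gain : ∀ i, c i < utility (u i) (x i)

/-- Optimal solutions of the program that maximizes `∑ i, log (v i - c i)`. -/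
structure IsNashSolution [Fintype A] [Fintype G] (u : A → G → ℝ) (c : A → ℝ)
    (x : A → G → ℝ) : Prop where
  point : IsProgramPoint u c x
  optimal : ∀ y, IsProgramPoint u c y →
    ∑ i, Real.log (utility (u i) (y i) - c i) ≤ ∑ i, Real.log (utility (u i) (x i) - c i)

/-! ### Matchings and vertex covers in the graph `H` with edges `{(i, j) | u i j = 1}` -/

/-- `M` is (the edge set of) a matching in `H[A', G']`. -/
structure IsMatching (u : A → G → ℝ) (A' : Finset A) (G' : Finset G)
    (M : Finset (A × G)) : Prop where
  mem : ∀ e ∈ M, e.1 ∈ A' ∧ e.2 ∈ G' ∧ u e.1 e.2 = 1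
  left : ∀ e ∈ M, ∀ f ∈ M, e.1 = f.1 → e = f
  right : ∀ e ∈ M, ∀ f ∈ M, e.2 = f.2 → e = f

/-- `M` is a matching of maximum size in `H[A', G']`. -/
def IsMaximumMatching (u : A → G → ℝ) (A' : Finset A) (G' : Finset G)
    (M : Finset (A × G)) : Prop :=
  IsMatching u A' G' M ∧ ∀ M', IsMatching u A' G' M' → M'.card ≤ M.card

/-- `M` is a perfect matching of `H`. -/
def IsPerfectMatching [Fintype A] [Fintype G] (u : A → G → ℝ) (M : Finset (A × G)) : Prop :=
  IsMatching u Finset.univ Finset.univ M ∧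
    (∀ i, ∃ j, (i, j) ∈ M) ∧ ∀ j, ∃ i, (i, j) ∈ M

/-- `G₁ ∪ A₂` is a vertex cover of `H`. -/
def IsVertexCover (u : A → G → ℝ) (A₂ : Finset A) (G₁ : Finset G) : Prop :=
  ∀ i j, u i j = 1 → i ∈ A₂ ∨ j ∈ G₁

/-- `G₁ ∪ A₂` is a vertex cover of `H` of minimum size. -/
def IsMinimumVertexCover (u : A → G → ℝ) (A₂ : Finset A) (G₁ : Finset G) : Prop :=
  IsVertexCover u A₂ G₁ ∧
    ∀ A' G', IsVertexCover u A' G' → A₂.card + G₁.card ≤ A'.card + G'.card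

/-- `G₁ ∪ A₂` is a minimum vertex cover of `H` that, among the minimum vertex covers, contains
the smallest number of agents. -/
def IsAgentMinimalCover (u : A → G → ℝ) (A₂ : Finset A) (G₁ : Finset G) : Prop :=
  IsMinimumVertexCover u A₂ G₁ ∧ ∀ A' G', IsMinimumVertexCover u A' G' → A₂.card ≤ A'.card

/-! ### Subroutine FLOW -/

/-- The agents of `A'` that are adjacent in `H` to some good of `S`. -/
def neighbors (u : A → G → ℝ) (A' : Finset A) (S : Finset G) : Finset A :=
  A'.filter fun i => ∃ j ∈ S, u i j = 1

/-- The current money of agent `i` when the current price is `θ`. -/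
def money (c : A → ℝ) (θ : ℝ) (i : A) : ℝ := 1 + c i * θ

/-- In `H[A', G']` with all goods at price `θ`, the nonempty set of goods `S` is tight: its total
price equals the total money of its neighbors. -/
def IsTight (u : A → G → ℝ) (c : A → ℝ) (A' : Finset A) (G' : Finset G) (θ : ℝ)
    (S : Finset G) : Prop :=
  S ⊆ G' ∧ S.Nonempty ∧ (S.card : ℝ) * θ = ∑ i ∈ neighbors u A' S, money c θ i

/-- The goods of `S`, priced at `θ`, are completely sold along edges of `H` to the neighbors of
`S` in `A'`, whose money is thereby exhausted; no other agent receives any part of `S`. -/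
structure SellsTo [Fintype A] (u : A → G → ℝ) (c : A → ℝ) (A' : Finset A) (θ : ℝ)
    (S : Finset G) (x : A → G → ℝ) : Prop where
  nonneg : ∀ i, ∀ j ∈ S, 0 ≤ x i j
  edges : ∀ i, ∀ j ∈ S, x i j ≠ 0 → i ∈ neighbors u A' S ∧ u i j = 1
  sold : ∀ j ∈ S, ∑ i, x i j = 1
  spent : ∀ i ∈ neighbors u A' S, ∑ j ∈ S, x i j * θ = money c θ i

/-- `Flow u c A' G' θ₀ x p`: a run of FLOW on the remaining graph `H[A', G']`, in which the
common price of the goods is raised from `θ₀` on, can assign to the goods of `G'` the prices `p`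
and the columns of `x`.  In each iteration the price rises to the least value `θ` at which some
set is tight, a maximal tight set `S` is sold at this price, and `S` and its neighbors are
removed. -/
inductive Flow [Fintype A] [DecidableEq A] [DecidableEq G] (u : A → G → ℝ) (c : A → ℝ) :
    Finset A → Finset G → ℝ → (A → G → ℝ) → (G → ℝ) → Prop
  | done (A' : Finset A) (θ₀ : ℝ) (x : A → G → ℝ) (p : G → ℝ) : Flow u c A' ∅ θ₀ x p
  | step (A' : Finset A) (G' : Finset G) (θ₀ θ : ℝ) (S : Finset G) (x : A → G → ℝ) (p : G → ℝ)
      (least : IsLeast {t | θ₀ ≤ t ∧ ∃ S', IsTight u c A' G' t S'} θ)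
      (maximal : Maximal (IsTight u c A' G' θ) S)
      (sells : SellsTo u c A' θ S x)
      (price : ∀ j ∈ S, p j = θ)
      (rest : Flow u c (A' \ neighbors u A' S) (G' \ S) θ x p) :
      Flow u c A' G' θ₀ x p

/-! ### The mechanism -/

/-- Agent `i` receives exactly the goods matched to her by `M`. -/
def GetsMatch (M : Finset (A × G)) (x : A → G → ℝ) (i : A) : Prop :=
  ∀ j, ((i, j) ∈ M → x i j = 1) ∧ ((i, j) ∉ M → x i j = 0)

/-- The output `(x, p, q)` when the perfect matching `M` of `H` is used. -/
structure PerfectOutput [Fintype A] [Fintype G] (u : A → G → ℝ) (c : A → ℝ)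
    (M : Finset (A × G)) (x : A → G → ℝ) (p : G → ℝ) (q : A → ℝ) : Prop where
  perfect : IsPerfectMatching u M
  alloc : ∀ i, GetsMatch M x i
  offset : ∀ i, q i = 1 / (1 - c i)
  price : ∀ j, p j = 0

/-- The output `(x, p, q)` when `H` has no perfect matching, the vertex cover `G₁ ∪ A₂` is chosen,
`M` is the maximum matching found in `H[A₂, G₂]`, and FLOW is run on `H[A₁, G₁]`, starting at
price `1`; here `A₁ = A - A₂` and `G₂ = G - G₁`.  Finally the goods of `G₂` that `M` leaves
unmatched are used to fill up every agent of `A₁` to one unit. -/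
structure CoverOutput [Fintype A] [Fintype G] [DecidableEq A] [DecidableEq G]
    (u : A → G → ℝ) (c : A → ℝ) (A₂ : Finset A) (G₁ : Finset G) (M : Finset (A × G))
    (x : A → G → ℝ) (p : G → ℝ) (q : A → ℝ) : Prop where
  no_perfect : ¬ ∃ M', IsPerfectMatching u M'
  cover : IsAgentMinimalCover u A₂ G₁
  matching : IsMaximumMatching u A₂ G₁ᶜ M
  alloc₂ : ∀ i ∈ A₂, GetsMatch M x i
  offset₂ : ∀ i ∈ A₂, q i = 1 / (1 - c i)
  price₂ : ∀ j ∈ G₁ᶜ, p j = 0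
  offset₁ : ∀ i ∈ A₂ᶜ, q i = 0
  flow : Flow u c A₂ᶜ G₁ 1 x p
  fill_nonneg : ∀ i ∈ A₂ᶜ, ∀ j ∈ G₁ᶜ, 0 ≤ x i j
  fill_unmatched : ∀ i ∈ A₂ᶜ, ∀ j ∈ G₁ᶜ, (∃ k, (k, j) ∈ M) → x i j = 0
  fill_capacity : ∀ j ∈ G₁ᶜ, ∑ i, x i j ≤ 1
  fill_size : ∀ i ∈ A₂ᶜ, ∑ j, x i j = 1

/-- `(x, p, q)` is an output of the mechanism, for some way of making its choices, on the
instance with reported utilities `u` and disagreement utilities `c`. -/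
def IsOutput [Fintype A] [Fintype G] [DecidableEq A] [DecidableEq G]
    (u : A → G → ℝ) (c : A → ℝ) (x : A → G → ℝ) (p : G → ℝ) (q : A → ℝ) : Prop :=
  (∃ M, PerfectOutput u c M x p q) ∨ ∃ A₂ G₁ M, CoverOutput u c A₂ G₁ M x p q

end OneDLAD

end

/-! ### Balanced allocations and strategyproofness -/

namespace OneDLAD

variable {A G : Type*}

/-! Both allocation rules produce balanced allocations, and between balanced allocations
misreporting cannot pay (`utility_le_of_isBalanced`). Call utility minus disagreement utility the
level of an agent.

Suppose `i` truly gains in passing from `x` to `x'`. An unsatiated gainer lies in a bottleneck set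
of `x` whose members have no higher level and which already exhausts all goods it likes; so a gain
inside the set forces a loss inside it, by an agent whose level in `x` is no higher. Let `k` be the
loser of least level in `x'`, and `X` her bottleneck set in `x'`. If `i ∉ X`, the same counting in
the opposite direction gives a gainer in `X`, and the bottleneck of this gainer in `x` gives a loser
whose level in `x'` is below that of `k`, which is impossible. If `i ∈ X`, the reported utility of
`i` in `x'` is below her true one, so she holds a good that she likes but reported not to like. Such
a filler good lies in a set satiating everybody else who likes one of its members; comparing sizes
then shows that `i` was already satiated under `x` (`one_le_utility_of_filler`).

For the mechanism, the bottlenecks are the agents remaining in FLOW at the time of sale, and the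
fillers lie among goods wanted only by satiated agents of the cover. For Nash solutions, both kinds
of sets consist of what is reachable by exchange chains that the first-order condition forbids to be
profitable. -/

/-- The goods that some agent of `X` likes. -/
noncomputable def likedGoods [Fintype G] (u : A → G → ℝ) (X : Finset A) : Finset G :=
  open Classical in Finset.univ.filter fun j => ∃ k ∈ X, u k j = 1

lemma mem_likedGoods [Fintype G] {u : A → G → ℝ} {X : Finset A} {j : G} :
    j ∈ likedGoods u X ↔ ∃ k ∈ X, u k j = 1 := by
  simp [likedGoods]

/-- Allocations in which every agent whose utility is below one is blocked by a set of agents,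
none of whom gains more than she does, that exhausts all the goods it likes, and in which goods
given to agents who do not like them lie in a set of goods that satiates everybody liking one of
its members. -/
structure IsBalanced [Fintype A] [Fintype G] (u : A → G → ℝ) (c : A → ℝ)
    (x : A → G → ℝ) : Prop where
  nonneg : ∀ i j, 0 ≤ x i j
  row : ∀ i, ∑ j, x i j ≤ 1
  col : ∀ j, ∑ i, x i j ≤ 1
  bottleneck : ∀ l, utility (u l) (x l) < 1 → ∃ X : Finset A, l ∈ X ∧
    (∀ k ∈ X, utility (u k) (x k) - c k ≤ utility (u l) (x l) - c l) ∧
    ((likedGoods u X).card : ℝ) ≤ ∑ k ∈ X, utility (u k) (x k)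
  filler : ∀ m j₀, 0 < x m j₀ → u m j₀ = 0 → ∃ J : Finset G, j₀ ∈ J ∧
    ∀ l, (∃ j ∈ J, u l j = 1) → 1 ≤ ∑ j ∈ J, u l j * x l j

lemma Dichotomous.nonneg {w : G → ℝ} (hw : Dichotomous w) (j : G) : 0 ≤ w j := by
  rcases hw j with h | h <;> simp [h]

lemma Dichotomous.le_one {w : G → ℝ} (hw : Dichotomous w) (j : G) : w j ≤ 1 := by
  rcases hw j with h | h <;> simp [h]

lemma Dichotomous.eq_zero {w : G → ℝ} (hw : Dichotomous w) {j : G} (h : w j ≠ 1) : w j = 0 :=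
  (hw j).resolve_right h

lemma dichotomous_update [DecidableEq A] {u : A → G → ℝ}
    (hu : ∀ k, Dichotomous (u k)) (i : A) {r : G → ℝ} (hr : Dichotomous r) (k : A) :
    Dichotomous (Function.update u i r k) := by
  by_cases hk : k = i
  · subst hk
    rwa [Function.update_self]
  · rw [Function.update_of_ne hk]
    exact hu k

lemma utility_le_sum [Fintype G] {w b : G → ℝ} (hw : Dichotomous w) (hb : ∀ j, 0 ≤ b j) :
    utility w b ≤ ∑ j, b j :=
  Finset.sum_le_sum fun j _ => mul_le_of_le_one_left (hb j) (hw.le_one j)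

lemma sum_column_le [Fintype A] {u x : A → G → ℝ} (hu : ∀ k, Dichotomous (u k))
    (hx : ∀ i j, 0 ≤ x i j) (hcol : ∀ j, ∑ i, x i j ≤ 1) (X : Finset A) (j : G) :
    ∑ k ∈ X, u k j * x k j ≤ 1 :=
  calc ∑ k ∈ X, u k j * x k j ≤ ∑ k ∈ X, x k j :=
        Finset.sum_le_sum fun k _ => mul_le_of_le_one_left (hx k j) ((hu k).le_one j)
    _ ≤ ∑ k, x k j := Finset.sum_le_sum_of_subset_of_nonneg (Finset.subset_univ X)
        fun k _ _ => hx k j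
    _ ≤ 1 := hcol j

lemma utility_eq_sum_of_liked_subset [Fintype G] {w : G → ℝ} (hw : Dichotomous w) (b : G → ℝ)
    {T : Finset G} (hT : ∀ j, w j = 1 → j ∈ T) : utility w b = ∑ j ∈ T, w j * b j := by
  refine (Finset.sum_subset (Finset.subset_univ T) fun j _ hj => ?_).symm
  rw [hw.eq_zero fun h => hj (hT j h), zero_mul]

lemma sum_utility_eq [Fintype G] {u x : A → G → ℝ} (hu : ∀ k, Dichotomous (u k)) (X : Finset A) :
    ∑ k ∈ X, utility (u k) (x k) = ∑ j ∈ likedGoods u X, ∑ k ∈ X, u k j * x k j := by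
  rw [Finset.sum_comm]
  exact Finset.sum_congr rfl fun k hk =>
    utility_eq_sum_of_liked_subset (hu k) _ fun j hj => mem_likedGoods.2 ⟨k, hk, hj⟩

lemma sum_utility_le [Fintype A] [Fintype G] {u x : A → G → ℝ} (hu : ∀ k, Dichotomous (u k))
    (hx : ∀ i j, 0 ≤ x i j) (hcol : ∀ j, ∑ i, x i j ≤ 1) (X : Finset A) :
    ∑ k ∈ X, utility (u k) (x k) ≤ (likedGoods u X).card := by
  rw [sum_utility_eq hu]
  simpa using Finset.sum_le_sum fun j (_ : j ∈ likedGoods u X) => sum_column_le hu hx hcol X j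

/-- A set of agents that exhausts the goods it likes exhausts each part of them. -/
lemma card_inter_le_of_tight [Fintype A] [Fintype G] [DecidableEq G] {u x : A → G → ℝ}
    (hu : ∀ k, Dichotomous (u k)) (hx : ∀ i j, 0 ≤ x i j) (hcol : ∀ j, ∑ i, x i j ≤ 1)
    {X : Finset A} (htight : ((likedGoods u X).card : ℝ) ≤ ∑ k ∈ X, utility (u k) (x k))
    {T : Finset G} (hT : T ⊆ likedGoods u X) :
    (T.card : ℝ) ≤ ∑ j ∈ T, ∑ k ∈ X, u k j * x k j := by
  rw [sum_utility_eq hu, ← Finset.sum_sdiff hT, ← Finset.card_sdiff_add_card_eq_card hT] at htight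
  have h : ∑ j ∈ likedGoods u X \ T, ∑ k ∈ X, u k j * x k j ≤ (likedGoods u X \ T).card := by
    simpa using Finset.sum_le_sum fun j (_ : j ∈ likedGoods u X \ T) =>
      sum_column_le hu hx hcol X j
  push_cast at htight
  linarith

/-- An agent below utility one cannot like a good of a set that satiates all other agents who like
one of its members and of which she still holds a liked part. -/
lemma one_le_utility_of_filler [Fintype A] [Fintype G] [DecidableEq A] [DecidableEq G]
    {u : A → G → ℝ} (hu : ∀ k, Dichotomous (u k)) {c : A → ℝ} {x : A → G → ℝ}
    (hx : IsBalanced u c x) {y : A → G → ℝ} (hy : ∀ i j, 0 ≤ y i j)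
    (hycol : ∀ j, ∑ i, y i j ≤ 1) {i : A} {j₀ : G} (hij : u i j₀ = 1) (hpos : 0 < y i j₀)
    {J : Finset G} (hj₀ : j₀ ∈ J)
    (hJ : ∀ l ≠ i, (∃ j ∈ J, u l j = 1) → 1 ≤ ∑ j ∈ J, u l j * y l j) :
    1 ≤ utility (u i) (x i) := by
  classical
  by_contra! hlt
  obtain ⟨X, hiX, -, htight⟩ := hx.bottleneck i hlt
  -- Under `x`, `X` exhausts `T`, and only `i` and `L` take part, so `|T| < 1 + |L|`. Under `y`,
  -- each agent of `L` holds a full unit of `T` and `i` a positive amount, so `|L| < |T|`.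
  -- Integrality makes these incompatible.
  set T := J ∩ likedGoods u X with hTdef
  set L := (X.erase i).filter fun l => ∃ j ∈ J, u l j = 1 with hLdef
  have hiL : i ∉ L := by simp [hLdef]
  have hj₀T : j₀ ∈ T := Finset.mem_inter.2 ⟨hj₀, mem_likedGoods.2 ⟨i, hiX, hij⟩⟩
  have hLX : insert i L ⊆ X := by
    intro l hl
    rcases Finset.mem_insert.1 hl with rfl | hl
    · exact hiX
    · exact Finset.mem_of_mem_erase (Finset.mem_filter.1 hl).1
  have h1 := card_inter_le_of_tight hu hx.nonneg hx.col htight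
    (T := T) Finset.inter_subset_right
  have h2 : ∑ j ∈ T, ∑ k ∈ X, u k j * x k j ≤ utility (u i) (x i) + L.card := by
    rw [Finset.sum_comm, ← Finset.sum_subset hLX, Finset.sum_insert hiL]
    · have hle : ∀ k, ∑ j ∈ T, u k j * x k j ≤ utility (u k) (x k) := fun k =>
        Finset.sum_le_sum_of_subset_of_nonneg (Finset.subset_univ T)
          fun j _ _ => mul_nonneg ((hu k).nonneg j) (hx.nonneg k j)
      refine add_le_add (hle i) ?_
      simpa using Finset.sum_le_sum fun k (_ : k ∈ L) =>
        (hle k).trans ((utility_le_sum (hu k) (hx.nonneg k)).trans (hx.row k))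
    · intro k hk hkL
      refine Finset.sum_eq_zero fun j hj => ?_
      rw [(hu k).eq_zero, zero_mul]
      intro hkj
      refine hkL (Finset.mem_insert.2 (or_iff_not_imp_left.2 fun hki => ?_))
      exact Finset.mem_filter.2 ⟨Finset.mem_erase.2 ⟨hki, hk⟩, j, (Finset.mem_inter.1 hj).1, hkj⟩
  have h3 : (L.card : ℝ) ≤ ∑ l ∈ L, ∑ j ∈ T, u l j * y l j := by
    rw [← nsmul_one, ← Finset.sum_const]
    refine Finset.sum_le_sum fun l hl => ?_
    obtain ⟨hlX, hlJ⟩ := Finset.mem_filter.1 hl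
    refine (hJ l (Finset.ne_of_mem_erase hlX) hlJ).trans (le_of_eq ?_)
    refine (Finset.sum_subset Finset.inter_subset_left fun j hj hjT => ?_).symm
    rw [(hu l).eq_zero, zero_mul]
    exact fun h => hjT (Finset.mem_inter.2
      ⟨hj, mem_likedGoods.2 ⟨l, Finset.mem_of_mem_erase hlX, h⟩⟩)
  have h4 : 0 < ∑ j ∈ T, u i j * y i j :=
    Finset.sum_pos' (fun j _ => mul_nonneg ((hu i).nonneg j) (hy i j))
      ⟨j₀, hj₀T, by rw [hij, one_mul]; exact hpos⟩
  have h5 : ∑ k ∈ insert i L, ∑ j ∈ T, u k j * y k j ≤ T.card := by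
    rw [Finset.sum_comm]
    simpa using Finset.sum_le_sum fun j (_ : j ∈ T) => sum_column_le hu hy hycol (insert i L) j
  rw [Finset.sum_insert hiL] at h5
  have h6 : L.card < T.card := by exact_mod_cast (by linarith : (L.card : ℝ) < T.card)
  have h7 : (T.card : ℝ) < L.card + 1 := by linarith
  have h8 : T.card < L.card + 1 := by exact_mod_cast h7
  omega

/-- Misreporting does not pay when both allocations are balanced. -/
theorem utility_le_of_isBalanced [Fintype A] [Fintype G] [DecidableEq A] [DecidableEq G]
    {u : A → G → ℝ} (hu : ∀ k, Dichotomous (u k)) {c : A → ℝ} {i : A} {r : G → ℝ}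
    (hr : Dichotomous r) {x x' : A → G → ℝ} (hx : IsBalanced u c x)
    (hx' : IsBalanced (Function.update u i r) c x') :
    utility (u i) (x' i) ≤ utility (u i) (x i) := by
  classical
  by_contra! hgain
  set u' := Function.update u i r with hu'def
  have hu'i : u' i = r := by simp [hu'def]
  have hu'k : ∀ k, k ≠ i → u' k = u k := fun k hk => by simp [hu'def, hk]
  have hle : ∀ k, utility (u k) (x k) ≤ 1 := fun k =>
    (utility_le_sum (hu k) (hx.nonneg k)).trans (hx.row k)
  have hle' : ∀ k, utility (u k) (x' k) ≤ 1 := fun k =>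
    (utility_le_sum (hu k) (hx'.nonneg k)).trans (hx'.row k)
  -- The bottleneck set of a gainer has no spare goods, so somebody in it must pay for the gain.
  have loser : ∀ l, utility (u l) (x l) < utility (u l) (x' l) →
      ∃ m, utility (u m) (x' m) < utility (u m) (x m) ∧
        utility (u m) (x m) - c m ≤ utility (u l) (x l) - c l := by
    intro l hl
    obtain ⟨X, hlX, hlev, htight⟩ := hx.bottleneck l (hl.trans_le (hle' l))
    by_contra! hno
    have h1 := sum_utility_le hu hx'.nonneg hx'.col X
    have h2 : ∑ k ∈ X, utility (u k) (x k) < ∑ k ∈ X, utility (u k) (x' k) :=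
      Finset.sum_lt_sum (fun m hm => by
        by_contra! h
        exact absurd (hlev m hm) (not_le.2 (hno m h))) ⟨l, hlX, hl⟩
    linarith
  obtain ⟨m₀, hm₀, hm₀i⟩ := loser i hgain
  obtain ⟨k, hk, hmin⟩ := Finset.exists_min_image
    (Finset.univ.filter fun m => utility (u m) (x' m) < utility (u m) (x m))
    (fun m => utility (u m) (x' m) - c m) ⟨m₀, by simpa using hm₀⟩
  simp only [Finset.mem_filter, Finset.mem_univ, true_and] at hk hmin
  have hki : k ≠ i := by rintro rfl; exact absurd hk hgain.not_gt
  obtain ⟨X, hkX, hlev, htight⟩ := hx'.bottleneck k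
    (by rw [hu'k k hki]; exact hk.trans_le (hle k))
  rw [hu'k k hki] at hlev
  by_cases hiX : i ∈ X
  · have hi := hlev i hiX
    rw [hu'i] at hi
    -- Chain of levels: reported `i` in `x'` ≤ `k` in `x'` ≤ `m₀` in `x'` < `m₀` in `x` ≤ `i` in `x`
    -- < true `i` in `x'`.
    have hlt : utility r (x' i) < utility (u i) (x' i) := by
      have := hmin m₀ hm₀
      linarith
    obtain ⟨j₀, -, hj₀⟩ := Finset.exists_lt_of_sum_lt hlt
    have hx'j := hx'.nonneg i j₀
    have hrj : r j₀ = 0 := hr.eq_zero fun h => by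
      rw [h] at hj₀
      exact absurd hj₀ (not_lt.2 (mul_le_mul_of_nonneg_right ((hu i).le_one j₀) hx'j))
    rw [hrj, zero_mul] at hj₀
    have huj : u i j₀ = 1 := ((hu i) j₀).resolve_left fun h => by simp [h] at hj₀
    rw [huj, one_mul] at hj₀
    obtain ⟨J, hJ₀, hJ⟩ := hx'.filler i j₀ hj₀ (by rw [hu'i, hrj])
    have := one_le_utility_of_filler hu hx hx'.nonneg hx'.col huj hj₀ hJ₀ fun l hl hlJ => by
      simpa only [hu'k l hl] using hJ l (by simpa only [hu'k l hl] using hlJ)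
    linarith [hle' i]
  -- Without `i`, the set `X` is a bottleneck for the true utilities too, so the loss of `k` is
  -- offset by a gainer `l ∈ X`. A loser `m` found from `l` has level in `x'` below that of `l`,
  -- hence below that of `k`.
  · have hne : ∀ l ∈ X, u' l = u l := fun l hl => hu'k l fun h => hiX (h ▸ hl)
    have hliked : likedGoods u' X = likedGoods u X := by
      ext j
      simp only [mem_likedGoods]
      exact exists_congr fun l => and_congr_right fun hl => by rw [hne l hl]
    rw [hliked, Finset.sum_congr rfl fun l hl => by rw [hne l hl]] at htight
    have h1 := (sum_utility_le hu hx.nonneg hx.col X).trans htight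
    obtain ⟨l, hlX, hl⟩ : ∃ l ∈ X, utility (u l) (x l) < utility (u l) (x' l) := by
      by_contra! h
      exact absurd h1 (not_le.2 (Finset.sum_lt_sum h ⟨k, hkX, hk⟩))
    obtain ⟨m, hm, hml⟩ := loser l hl
    have h2 := hlev l hlX
    rw [hne l hlX] at h2
    have h3 := hmin m hm
    linarith

end OneDLAD

/-! ### Outputs of the mechanism are balanced -/

namespace OneDLAD

variable {A G : Type*}

/-- Every agent of a minimum vertex cover is matched by a maximum matching of the graph between
these agents and the goods outside of the cover. -/
lemma IsMaximumMatching.exists_mem [Fintype G] [DecidableEq A] [DecidableEq G] {u : A → G → ℝ} {A₂ : Finset A} {G₁ : Finset G}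
    (hcov : IsMinimumVertexCover u A₂ G₁) {M : Finset (A × G)}
    (hM : IsMaximumMatching u A₂ G₁ᶜ M) {i : A} (hi : i ∈ A₂) : ∃ j, (i, j) ∈ M := by
  classical
  let t : A₂ → Finset G := fun k => G₁ᶜ.filter fun j => u k j = 1
  -- Hall's condition: a set of cover agents with too few neighbours outside `G₁` could be exchanged
  -- for these neighbours, giving a smaller cover.
  have hall : ∀ s : Finset A₂, s.card ≤ (s.biUnion t).card := by
    intro s
    set s' := s.map (Function.Embedding.subtype _) with hs'
    have hsub : s' ⊆ A₂ := fun a ha => by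
      obtain ⟨b, -, rfl⟩ := Finset.mem_map.1 ha
      exact b.2
    have h1 := hcov.2 (A₂ \ s') (G₁ ∪ s.biUnion t) fun k j hkj => by
      rcases hcov.1 k j hkj with hk | hj
      · by_cases hks : k ∈ s'
        · by_cases hj : j ∈ G₁
          · exact Or.inr (Finset.mem_union_left _ hj)
          · obtain ⟨b, hb, rfl⟩ := Finset.mem_map.1 hks
            exact Or.inr (Finset.mem_union_right _ (Finset.mem_biUnion.2
              ⟨b, hb, Finset.mem_filter.2 ⟨Finset.mem_compl.2 hj, hkj⟩⟩))
        · exact Or.inl (Finset.mem_sdiff.2 ⟨hk, hks⟩)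
      · exact Or.inr (Finset.mem_union_left _ hj)
    have h2 := Finset.card_sdiff_add_card_eq_card hsub
    have h3 : s'.card = s.card := Finset.card_map _
    have h4 := Finset.card_union_le G₁ (s.biUnion t)
    omega
  obtain ⟨f, hf, hft⟩ := (Finset.all_card_le_biUnion_card_iff_exists_injective t).1 hall
  have hcard : A₂.card ≤ M.card := by
    have hinj : Function.Injective fun k : A₂ => ((k : A), f k) := fun a b hab =>
      Subtype.ext (Prod.ext_iff.1 hab).1
    have h := hM.2 (Finset.univ.map ⟨_, hinj⟩) ⟨?_, ?_, ?_⟩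
    · simpa using h
    · intro e he
      obtain ⟨k, -, rfl⟩ := Finset.mem_map.1 he
      obtain ⟨h1, h2⟩ := Finset.mem_filter.1 (hft k)
      exact ⟨k.2, h1, h2⟩
    · intro e he g hg heg
      obtain ⟨k, -, rfl⟩ := Finset.mem_map.1 he
      obtain ⟨l, -, rfl⟩ := Finset.mem_map.1 hg
      have : k = l := Subtype.ext heg
      rw [this]
    · intro e he g hg heg
      obtain ⟨k, -, rfl⟩ := Finset.mem_map.1 he
      obtain ⟨l, -, rfl⟩ := Finset.mem_map.1 hg
      have : k = l := hf heg
      rw [this]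
  have himage : M.image Prod.fst = A₂ := by
    refine Finset.eq_of_subset_of_card_le (fun a ha => ?_) ?_
    · obtain ⟨e, he, rfl⟩ := Finset.mem_image.1 ha
      exact (hM.1.mem e he).1
    · rwa [Finset.card_image_of_injOn fun e he g hg => hM.1.left e he g hg]
  rw [← himage] at hi
  obtain ⟨e, he, rfl⟩ := Finset.mem_image.1 hi
  exact ⟨e.2, he⟩

lemma GetsMatch.eq_ite [DecidableEq G] {M : Finset (A × G)} {x : A → G → ℝ} {i : A}
    (h : GetsMatch M x i) {u : A → G → ℝ} {A' : Finset A} {G' : Finset G} (hM : IsMatching u A' G' M) {j₁ : G}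
    (hj₁ : (i, j₁) ∈ M) (j : G) : x i j = if j = j₁ then 1 else 0 := by
  split_ifs with hj
  · rw [hj]
    exact (h j₁).1 hj₁
  · refine (h j).2 fun hij => hj ?_
    exact (Prod.ext_iff.1 (hM.left _ hij _ hj₁ rfl)).2

variable [Fintype A] [Fintype G] [DecidableEq A] [DecidableEq G]

/-- What FLOW guarantees on a remaining graph outside of which its agents like nothing. -/
lemma Flow.spec {u : A → G → ℝ} (hu : ∀ k, Dichotomous (u k)) {c : A → ℝ} (hc : ∀ k, 0 ≤ c k)
    {A' : Finset A} {G' : Finset G} {θ₀ : ℝ} {x : A → G → ℝ} {p : G → ℝ}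
    (h : Flow u c A' G' θ₀ x p) (hθ : 0 < θ₀) (hN : ∀ k ∈ A', ∀ j, u k j = 1 → j ∈ G') :
    (∀ i, ∀ j ∈ G', 0 ≤ x i j) ∧ (∀ j ∈ G', ∑ i, x i j = 1) ∧
    (∀ i, ∀ j ∈ G', x i j ≠ 0 → i ∈ A' ∧ u i j = 1) ∧
    (∀ k ∈ A', utility (u k) (x k) - c k ≤ 1 / θ₀) ∧
    ∀ l ∈ A', ∃ X : Finset A, l ∈ X ∧
      (∀ k ∈ X, utility (u k) (x k) - c k ≤ utility (u l) (x l) - c l) ∧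
      ((likedGoods u X).card : ℝ) ≤ ∑ k ∈ X, utility (u k) (x k) := by
  induction h with
  | done A' θ₀ x p =>
    -- No goods remain, so the remaining agents like nothing and `{l}` is a bottleneck trivially.
    have hzero : ∀ k ∈ A', utility (u k) (x k) = 0 := fun k hk => by
      rw [utility_eq_sum_of_liked_subset (hu k) _ (hN k hk), Finset.sum_empty]
    refine ⟨by simp, by simp, by simp, fun k hk => ?_, fun l hl => ⟨{l}, by simp, by simp, ?_⟩⟩
    · rw [hzero k hk]
      have := one_div_pos.2 hθ
      linarith [hc k]
    · have : likedGoods u {l} = ∅ := by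
        refine Finset.eq_empty_of_forall_notMem fun j hj => ?_
        obtain ⟨k, hk, hkj⟩ := mem_likedGoods.1 hj
        rw [Finset.mem_singleton.1 hk] at hkj
        exact Finset.notMem_empty _ (hN l hl j hkj)
      simp [this, hzero l hl]
  | step A' G' θ₀ θ S x p least maximal sells price rest ih =>
    have hθ' : 0 < θ := hθ.trans_le least.1.1
    have hSG : S ⊆ G' := maximal.prop.1
    obtain ⟨hnn, hsold, hedge, hlev, hbot⟩ := ih hθ' fun k hk j hj => by
      obtain ⟨hkA, hkS⟩ := Finset.mem_sdiff.1 hk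
      exact Finset.mem_sdiff.2 ⟨hN k hkA j hj, fun hjS =>
        hkS (Finset.mem_filter.2 ⟨hkA, j, hjS, hj⟩)⟩
    have nonneg : ∀ i, ∀ j ∈ G', 0 ≤ x i j := fun i j hj => by
      by_cases hjS : j ∈ S
      · exact sells.nonneg i j hjS
      · exact hnn i j (Finset.mem_sdiff.2 ⟨hj, hjS⟩)
    have sold : ∀ j ∈ G', ∑ i, x i j = 1 := fun j hj => by
      by_cases hjS : j ∈ S
      · exact sells.sold j hjS
      · exact hsold j (Finset.mem_sdiff.2 ⟨hj, hjS⟩)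
    have edge : ∀ i, ∀ j ∈ G', x i j ≠ 0 → i ∈ A' ∧ u i j = 1 := fun i j hj hij => by
      by_cases hjS : j ∈ S
      · obtain ⟨h1, h2⟩ := sells.edges i j hjS hij
        exact ⟨(Finset.mem_filter.1 h1).1, h2⟩
      · obtain ⟨h1, h2⟩ := hedge i j (Finset.mem_sdiff.2 ⟨hj, hjS⟩) hij
        exact ⟨(Finset.mem_sdiff.1 h1).1, h2⟩
    -- Spending `1 + c k * θ` at price `θ` buys `c k + 1 / θ` units, all of them liked.
    have hutil : ∀ k ∈ neighbors u A' S, utility (u k) (x k) - c k = 1 / θ := fun k hk => by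
      have hkA := (Finset.mem_filter.1 hk).1
      have h1 : ∑ j ∈ S, u k j * x k j = ∑ j ∈ G', u k j * x k j := by
        refine Finset.sum_subset hSG fun j hj hjS => ?_
        have : x k j = 0 := by
          by_contra h0
          exact (Finset.mem_sdiff.1 (hedge k j (Finset.mem_sdiff.2 ⟨hj, hjS⟩) h0).1).2 hk
        rw [this, mul_zero]
      have h2 : ∑ j ∈ S, u k j * x k j = ∑ j ∈ S, x k j := Finset.sum_congr rfl fun j hj => by
        by_cases h0 : x k j = 0
        · simp [h0]
        · rw [(sells.edges k j hj h0).2, one_mul]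
      have h3 := sells.spent k hk
      rw [← Finset.sum_mul, money] at h3
      rw [utility_eq_sum_of_liked_subset (hu k) _ (hN k hkA), ← h1, h2]
      field_simp
      linarith
    have hlevel : ∀ k ∈ A', utility (u k) (x k) - c k ≤ 1 / θ := fun k hk => by
      by_cases hkS : k ∈ neighbors u A' S
      · exact (hutil k hkS).le
      · exact hlev k (Finset.mem_sdiff.2 ⟨hk, hkS⟩)
    refine ⟨nonneg, sold, edge, fun k hk =>
      (hlevel k hk).trans (one_div_le_one_div_of_le hθ least.1.1), fun l hl => ?_⟩
    by_cases hlS : l ∈ neighbors u A' S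
    -- The bottleneck is everybody still present: later sales happen at prices at least `θ`, hence
    -- at levels at most `1 / θ`, and all of `G'` goes to agents of `A'` who like it.
    · refine ⟨A', hl, fun k hk => (hlevel k hk).trans (hutil l hlS).ge, ?_⟩
      have h1 : likedGoods u A' ⊆ G' := fun j hj => by
        obtain ⟨k, hk, hkj⟩ := mem_likedGoods.1 hj
        exact hN k hk j hkj
      have h2 : ∑ k ∈ A', utility (u k) (x k) = G'.card := by
        rw [Finset.sum_congr rfl fun k hk =>
          utility_eq_sum_of_liked_subset (hu k) (x k) (hN k hk), Finset.sum_comm,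
          ← nsmul_one, ← Finset.sum_const]
        refine Finset.sum_congr rfl fun j hj => ?_
        rw [← sold j hj]
        refine (Finset.sum_congr rfl fun k _ => ?_).trans
          (Finset.sum_subset (Finset.subset_univ A') fun k _ hk => ?_)
        · by_cases h0 : x k j = 0
          · simp [h0]
          · rw [(edge k j hj h0).2, one_mul]
        · by_contra h0
          exact hk (edge k j hj h0).1
      rw [h2]
      exact_mod_cast Finset.card_le_card h1
    · exact hbot l (Finset.mem_sdiff.2 ⟨hl, hlS⟩)

lemma PerfectOutput.isBalanced {u : A → G → ℝ} {c : A → ℝ} {M : Finset (A × G)}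
    {x : A → G → ℝ} {p : G → ℝ} {q : A → ℝ} (h : PerfectOutput u c M x p q) :
    IsBalanced u c x := by
  obtain ⟨hM, hA, hG⟩ := h.perfect
  have hpos : ∀ m j, x m j ≠ 0 → (m, j) ∈ M := fun m j hm => by
    by_contra hmj
    exact hm ((h.alloc m j).2 hmj)
  have hutil : ∀ l, utility (u l) (x l) = 1 := fun l => by
    obtain ⟨j, hj⟩ := hA l
    simp [utility, (h.alloc l).eq_ite hM hj, (hM.mem _ hj).2.2]
  refine ⟨fun i j => ?_, fun i => ?_, fun j => ?_, fun l hl => absurd hl (hutil l).not_lt,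
    fun m j₀ hm hm0 => ?_⟩
  · by_cases hij : (i, j) ∈ M
    · simp [(h.alloc i j).1 hij]
    · simp [(h.alloc i j).2 hij]
  · obtain ⟨j, hj⟩ := hA i
    simp [(h.alloc i).eq_ite hM hj]
  · obtain ⟨i, hi⟩ := hG j
    rw [Finset.sum_eq_single i, (h.alloc i j).1 hi]
    · intro k _ hk
      by_contra h0
      exact hk (Prod.ext_iff.1 (hM.right _ (hpos k j h0) _ hi rfl)).1
    · simp
  · have h1 := (hM.mem _ (hpos m j₀ hm.ne')).2.2
    simp [hm0] at h1

/-- Agents of `A₂` are satiated by the matching, and the others like only goods of `G₁`, where FLOW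
supplies their bottlenecks. Disliked goods are handed out only from `G₁ᶜ`, all of whose admirers are
in `A₂` and are satiated within `G₁ᶜ`. -/
lemma CoverOutput.isBalanced {u : A → G → ℝ} (hu : ∀ k, Dichotomous (u k)) {c : A → ℝ}
    (hc : ∀ k, 0 ≤ c k) {A₂ : Finset A} {G₁ : Finset G} {M : Finset (A × G)}
    {x : A → G → ℝ} {p : G → ℝ} {q : A → ℝ} (h : CoverOutput u c A₂ G₁ M x p q) :
    IsBalanced u c x := by
  have hcov := h.cover.1
  have hM := h.matching.1
  have hN : ∀ k ∈ A₂ᶜ, ∀ j, u k j = 1 → j ∈ G₁ := fun k hk j hkj =>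
    (hcov.1 k j hkj).resolve_left (Finset.mem_compl.1 hk)
  obtain ⟨hnn, hsold, hedge, -, hbot⟩ := h.flow.spec hu hc one_pos hN
  have hmatch : ∀ l ∈ A₂, ∃ j ∈ G₁ᶜ, u l j = 1 ∧ ∀ j', x l j' = if j' = j then 1 else 0 :=
    fun l hl => by
      obtain ⟨j, hj⟩ := h.matching.exists_mem hcov hl
      exact ⟨j, (hM.mem _ hj).2.1, (hM.mem _ hj).2.2, (h.alloc₂ l hl).eq_ite hM hj⟩
  refine ⟨fun i j => ?_, fun i => ?_, fun j => ?_, fun l hl => ?_, fun m j₀ hm hm0 => ?_⟩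
  · by_cases hi : i ∈ A₂
    · obtain ⟨j', -, -, hx⟩ := hmatch i hi
      rw [hx]
      split_ifs <;> norm_num
    · by_cases hj : j ∈ G₁
      · exact hnn i j hj
      · exact h.fill_nonneg i (Finset.mem_compl.2 hi) j (Finset.mem_compl.2 hj)
  · by_cases hi : i ∈ A₂
    · obtain ⟨j', -, -, hx⟩ := hmatch i hi
      simp [hx]
    · exact (h.fill_size i (Finset.mem_compl.2 hi)).le
  · by_cases hj : j ∈ G₁
    · exact (hsold j hj).le
    · exact h.fill_capacity j (Finset.mem_compl.2 hj)
  · by_cases hlA : l ∈ A₂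
    · obtain ⟨j', -, hlj, hx⟩ := hmatch l hlA
      simp [utility, hx, hlj] at hl
    · exact hbot l (Finset.mem_compl.2 hlA)
  · have hmA : m ∉ A₂ := fun hmA => by
      obtain ⟨j', -, hlj, hx⟩ := hmatch m hmA
      rw [hx] at hm
      split_ifs at hm with hj
      · rw [hj, hlj] at hm0
        exact one_ne_zero hm0
      · exact lt_irrefl _ hm
    have hj₀ : j₀ ∈ G₁ᶜ := Finset.mem_compl.2 fun hj => by
      have := (hedge m j₀ hj hm.ne').2
      rw [hm0] at this
      exact zero_ne_one this
    refine ⟨G₁ᶜ, hj₀, fun l ⟨j, hj, hlj⟩ => ?_⟩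
    have hlA : l ∈ A₂ := (hcov.1 l j hlj).resolve_right (Finset.mem_compl.1 hj)
    obtain ⟨j', hj', hlj', hx⟩ := hmatch l hlA
    simp only [hx, mul_ite, mul_one, mul_zero, Finset.sum_ite_eq', if_pos hj', hlj', le_refl]

lemma IsOutput.isBalanced {u : A → G → ℝ} (hu : ∀ k, Dichotomous (u k)) {c : A → ℝ}
    (hc : ∀ k, 0 ≤ c k) {x : A → G → ℝ} {p : G → ℝ} {q : A → ℝ} (h : IsOutput u c x p q) :
    IsBalanced u c x := by
  rcases h with ⟨M, h⟩ | ⟨A₂, G₁, M, h⟩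
  · exact h.isBalanced
  · exact h.isBalanced hu hc

end OneDLAD

/-! ### Nash bargaining solutions are balanced -/

namespace OneDLAD

variable {A G : Type*} [Fintype A] [Fintype G]

open Filter Topology

/-- A constraint with slack survives every small step; only active ones restrict the direction. This
is why `IsDirection` has conditions at zero entries and full totals only. -/
lemma eventually_nonneg_add_mul {a b : ℝ} (ha : 0 ≤ a) (hb : a = 0 → 0 ≤ b) :
    ∀ᶠ t : ℝ in 𝓝[>] 0, 0 ≤ a + t * b := by
  rcases ha.eq_or_lt with h | h
  · filter_upwards [self_mem_nhdsWithin] with t ht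
    rw [← h, zero_add]
    exact mul_nonneg (le_of_lt ht) (hb h.symm)
  · have hc : ContinuousAt (fun t : ℝ => a + t * b) 0 := by fun_prop
    have := hc.eventually_const_lt (show 0 < a + 0 * b by simpa using h)
    exact (this.filter_mono nhdsWithin_le_nhds).mono fun t ht => ht.le

lemma utility_add_mul (w b d : G → ℝ) (t : ℝ) :
    utility w (fun j => b j + t * d j) = utility w b + t * utility w d := by
  simp only [utility, mul_add, Finset.sum_add_distrib, Finset.mul_sum]
  congr 1
  exact Finset.sum_congr rfl fun j _ => by ring

/-- `d` is a direction in which one can leave the allocation `x`, except that the totals of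
exhausted agents and goods may grow at the rates `r` and `s`. -/
structure IsDirection (x : A → G → ℝ) (r : A → ℝ) (s : G → ℝ) (d : A → G → ℝ) : Prop where
  sign : ∀ k j, x k j = 0 → 0 ≤ d k j
  row : ∀ k, ∑ j, x k j = 1 → ∑ j, d k j ≤ r k
  col : ∀ j, ∑ k, x k j = 1 → ∑ k, d k j ≤ s j

/-- The derivative of `∑ k, log (v k - c k)` in direction `d`. -/
noncomputable def slope (u : A → G → ℝ) (c : A → ℝ) (x d : A → G → ℝ) : ℝ :=
  ∑ k, utility (u k) (d k) / (utility (u k) (x k) - c k)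

/-- The first-order condition for optimal solutions of the Nash bargaining program. -/
lemma IsNashSolution.slope_nonpos {u : A → G → ℝ} {c : A → ℝ} {x : A → G → ℝ}
    (hx : IsNashSolution u c x) {r : A → ℝ} {s : G → ℝ} {d : A → G → ℝ}
    (hd : IsDirection x r s d) (hr : ∀ k, r k ≤ 0) (hs : ∀ j, s j ≤ 0) : slope u c x d ≤ 0 := by
  have hP := hx.point
  have hg : ∀ k, 0 < utility (u k) (x k) - c k := fun k => sub_pos.2 (hP.gain k)
  have hnn : ∀ᶠ t : ℝ in 𝓝[>] 0, ∀ k j, 0 ≤ x k j + t * d k j :=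
    eventually_all.2 fun k => eventually_all.2 fun j =>
      eventually_nonneg_add_mul (hP.nonneg k j) (hd.sign k j)
  have hrow : ∀ᶠ t : ℝ in 𝓝[>] 0, ∀ k, 0 ≤ (1 - ∑ j, x k j) + t * -∑ j, d k j :=
    eventually_all.2 fun k => eventually_nonneg_add_mul (sub_nonneg.2 (hP.row k)) fun h =>
      neg_nonneg.2 ((hd.row k (sub_eq_zero.1 h).symm).trans (hr k))
  have hcol : ∀ᶠ t : ℝ in 𝓝[>] 0, ∀ j, 0 ≤ (1 - ∑ k, x k j) + t * -∑ k, d k j :=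
    eventually_all.2 fun j => eventually_nonneg_add_mul (sub_nonneg.2 (hP.col j)) fun h =>
      neg_nonneg.2 ((hd.col j (sub_eq_zero.1 h).symm).trans (hs j))
  have hgain : ∀ᶠ t : ℝ in 𝓝[>] 0, ∀ k,
      0 < (utility (u k) (x k) - c k) + t * utility (u k) (d k) :=
    eventually_all.2 fun k => by
      have hc : ContinuousAt (fun t : ℝ =>
          (utility (u k) (x k) - c k) + t * utility (u k) (d k)) 0 := by fun_prop
      exact (hc.eventually_const_lt (by simpa using hP.gain k)).filter_mono nhdsWithin_le_nhds
  let f : ℝ → ℝ := fun t =>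
    ∑ k, Real.log ((utility (u k) (x k) - c k) + t * utility (u k) (d k))
  have hderiv : HasDerivAt f (slope u c x d) 0 := by
    refine HasDerivAt.fun_sum fun k _ => ?_
    have h1 : HasDerivAt (fun t : ℝ => (utility (u k) (x k) - c k) + t * utility (u k) (d k))
        (utility (u k) (d k)) 0 := by
      simpa using ((hasDerivAt_id (0 : ℝ)).mul_const (utility (u k) (d k))).const_add
        (utility (u k) (x k) - c k)
    simpa using h1.log (by simpa using (hg k).ne')
  have hle : ∀ᶠ t : ℝ in 𝓝[>] 0, f t ≤ f 0 := by
    filter_upwards [hnn, hrow, hcol, hgain] with t h1 h2 h3 h4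
    have heq : ∀ k, utility (u k) (fun j => x k j + t * d k j) - c k =
        (utility (u k) (x k) - c k) + t * utility (u k) (d k) := fun k => by
      rw [utility_add_mul]; ring
    have := hx.optimal (fun k j => x k j + t * d k j) ⟨h1, fun k => ?_, fun j => ?_, fun k => ?_⟩
    · simpa [f, heq] using this
    · rw [Finset.sum_add_distrib, ← Finset.mul_sum]
      linarith [h2 k]
    · rw [Finset.sum_add_distrib, ← Finset.mul_sum]
      linarith [h3 j]
    · rw [← sub_pos, heq]
      exact h4 k
  have ht := (hasDerivWithinAt_iff_tendsto_slope' (s := Set.Ioi 0) (by simp)).1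
    (hderiv.hasDerivWithinAt (s := Set.Ioi 0))
  refine le_of_tendsto ht ?_
  filter_upwards [hle, self_mem_nhdsWithin] with t h1 h2
  rw [slope_def_field]
  exact div_nonpos_of_nonpos_of_nonneg (sub_nonpos.2 h1) (by simpa using le_of_lt h2)

lemma isDirection_zero (x : A → G → ℝ) : IsDirection x 0 0 0 :=
  ⟨fun _ _ _ => le_rfl, fun _ _ => by simp, fun _ _ => by simp⟩

lemma slope_zero (u : A → G → ℝ) (c : A → ℝ) (x : A → G → ℝ) : slope u c x 0 = 0 := by
  simp [slope, utility]

variable [DecidableEq A] [DecidableEq G]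

/-- The direction `d`, changed so that agent `k` receives good `j` at an additional rate `a`. -/
def transfer (d : A → G → ℝ) (a : ℝ) (k : A) (j : G) : A → G → ℝ :=
  fun m b => d m b + if m = k then (if b = j then a else 0) else 0

lemma IsDirection.transfer {x : A → G → ℝ} {r : A → ℝ} {s : G → ℝ} {d : A → G → ℝ}
    (hd : IsDirection x r s d) {a : ℝ} {k : A} {j : G} (h : x k j ≠ 0 ∨ 0 ≤ a) :
    IsDirection x (fun m => r m + if m = k then a else 0) (fun b => s b + if b = j then a else 0)
      (transfer d a k j) where
  sign m b hmb := by
    have := hd.sign m b hmb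
    unfold OneDLAD.transfer
    split_ifs with h1 h2
    · subst h1 h2
      exact add_nonneg this (h.resolve_left fun h => h hmb)
    · simpa using this
    · simpa using this
  row m hm := by
    have := hd.row m hm
    by_cases h1 : m = k <;> simp [OneDLAD.transfer, Finset.sum_add_distrib, h1] <;>
      simpa [h1] using this
  col b hb := by
    have := hd.col b hb
    by_cases h1 : b = j <;> simp [OneDLAD.transfer, Finset.sum_add_distrib, h1] <;>
      simpa [h1] using this

lemma slope_transfer (u : A → G → ℝ) (c : A → ℝ) (x d : A → G → ℝ) (a : ℝ) (k : A) (j : G) :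
    slope u c x (transfer d a k j) =
      slope u c x d + u k j * a / (utility (u k) (x k) - c k) := by
  have h : ∀ m, utility (u m) (transfer d a k j m) =
      utility (u m) (d m) + if m = k then u k j * a else 0 := fun m => by
    by_cases hm : m = k
    · subst hm
      simp [utility, transfer, mul_add, Finset.sum_add_distrib]
    · simp [utility, transfer, hm]
  simp [slope, h, add_div, Finset.sum_add_distrib, ite_div]

/-- Room in the bundle of `l` is passed along exchange chains, and the bottleneck is the set of
agents reached. The marginal values telescope along a chain, leaving `1 / g l - 1 / g k`, which
optimality keeps nonpositive. -/
lemma IsNashSolution.exists_bottleneck {u : A → G → ℝ} (hu : ∀ k, Dichotomous (u k)) {c : A → ℝ}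
    {x : A → G → ℝ} (hx : IsNashSolution u c x) {l : A} (hl : utility (u l) (x l) < 1) :
    ∃ X : Finset A, l ∈ X ∧
      (∀ k ∈ X, utility (u k) (x k) - c k ≤ utility (u l) (x l) - c l) ∧
      ((likedGoods u X).card : ℝ) ≤ ∑ k ∈ X, utility (u k) (x k) := by
  classical
  have hP := hx.point
  set g : A → ℝ := fun k => utility (u k) (x k) - c k with hgdef
  have hg : ∀ k, 0 < g k := fun k => sub_pos.2 (hP.gain k)
  -- the agents to whom a rate of room in the bundle of `l` can be passed on
  let R : A → Prop := fun k => ∃ d, IsDirection x (fun m => if m = k then -1 else 0) 0 d ∧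
    1 / g l - 1 / g k ≤ slope u c x d
  -- If `l` holds a full unit, some of it is disliked and can be dropped at no loss; otherwise she
  -- has room already and the zero direction serves.
  have hRl : R l := by
    by_cases hrow : ∑ j, x l j = 1
    · have hlt : ∑ j, u l j * x l j < ∑ j, x l j := by rw [hrow]; exact hl
      obtain ⟨j, -, hj⟩ := Finset.exists_lt_of_sum_lt hlt
      have huj : u l j = 0 := (hu l).eq_zero fun h => by simp [h] at hj
      have hxj : x l j ≠ 0 := fun h => by simp [h] at hj
      have hd := (isDirection_zero x).transfer (a := -1) (Or.inl hxj)
      refine ⟨_, ⟨hd.sign, fun k hk => (hd.row k hk).trans (by simp),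
        fun b hb => (hd.col b hb).trans ?_⟩, ?_⟩
      · simp only [Pi.zero_apply]
        split_ifs <;> norm_num
      · simp [slope_transfer, slope_zero, huj]
    · refine ⟨0, ⟨fun _ _ _ => le_rfl, fun k hk => ?_, fun j _ => by simp⟩, by simp [slope_zero]⟩
      have : k ≠ l := by rintro rfl; exact hrow hk
      simp [this]
  have hlevel : ∀ k, R k → g k ≤ g l := by
    rintro k ⟨d, hd, hs⟩
    have := hx.slope_nonpos hd (fun m => by split_ifs <;> norm_num) fun _ => le_rfl
    exact (one_div_le_one_div (hg l) (hg k)).1 (by linarith)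
  -- Filling the room of `k` with `j` raises the slope to at least `1 / g l > 0`. If `j` is not
  -- fully allocated, or a holder does not like it, the result is an improving direction; otherwise
  -- taking `j` from a holder `m` costs `1 / g m` and moves the room to `m`.
  have hstep : ∀ k, R k → ∀ j, u k j = 1 →
      ∑ m, x m j = 1 ∧ ∀ m, x m j ≠ 0 → u m j = 1 ∧ R m := by
    rintro k ⟨d, hd, hs⟩ j hkj
    have hd1 := hd.transfer (a := 1) (k := k) (j := j) (Or.inr zero_le_one)
    have hs1 : 1 / g l ≤ slope u c x (transfer d 1 k j) := by
      rw [slope_transfer, hkj, mul_one]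
      change _ ≤ _ + 1 / g k
      linarith
    have hpos := one_div_pos.2 (hg l)
    refine ⟨?_, fun m hm => ?_⟩
    · by_contra hcol
      have := hx.slope_nonpos (r := 0) (s := 0) (d := transfer d 1 k j)
        ⟨hd1.sign, fun m hm => (hd1.row m hm).trans (by by_cases h : m = k <;> simp [h]),
          fun b hb => (hd1.col b hb).trans ?_⟩ (fun _ => le_rfl) fun _ => le_rfl
      · linarith
      · have : b ≠ j := by rintro rfl; exact hcol hb
        simp [this]
    · have hd2 := hd1.transfer (a := -1) (Or.inl hm)
      have hd3 : IsDirection x (fun a => if a = m then -1 else 0) 0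
          (transfer (transfer d 1 k j) (-1) m j) :=
        ⟨hd2.sign, fun a ha => (hd2.row a ha).trans (by by_cases h : a = k <;> simp [h]),
          fun b hb => (hd2.col b hb).trans (by by_cases h : b = j <;> simp [h])⟩
      have hs3 := slope_transfer u c x (transfer d 1 k j) (-1) m j
      rcases hu m j with h0 | h1
      · have := hx.slope_nonpos hd3 (fun a => by split_ifs <;> norm_num) fun _ => le_rfl
        rw [hs3, h0] at this
        simp only [zero_mul, zero_div, add_zero] at this
        linarith
      · refine ⟨h1, _, hd3, ?_⟩
        rw [hs3, h1, one_mul, neg_div]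
        change _ ≤ _ + -(1 / g m)
        linarith
  refine ⟨Finset.univ.filter R, by simpa using hRl, fun k hk => hlevel k (by simpa using hk), ?_⟩
  rw [sum_utility_eq hu, ← nsmul_one, ← Finset.sum_const]
  refine Finset.sum_le_sum fun j hj => ?_
  obtain ⟨k, hk, hkj⟩ := mem_likedGoods.1 hj
  obtain ⟨hsum, hto⟩ := hstep k (by simpa using hk) j hkj
  rw [← hsum, ← Finset.sum_subset (Finset.subset_univ (Finset.univ.filter R)) fun m _ hm => by
    by_contra h0
    exact hm (by simpa using (hto m h0).2)]
  refine Finset.sum_le_sum fun m _ => ?_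
  by_cases h0 : x m j = 0
  · simp [h0]
  · rw [(hto m h0).1, one_mul]

/-- The dual chains: a disliked good in someone's hands can be freed at no cost, and whoever likes a
freed good may take it in exchange for another. The goods so reached form `J`; an admirer with spare
room or a disliked holding would turn the chain into an improvement. -/
lemma IsNashSolution.exists_filler {u : A → G → ℝ} (hu : ∀ k, Dichotomous (u k)) {c : A → ℝ}
    {x : A → G → ℝ} (hx : IsNashSolution u c x) {m : A} {j₀ : G} (hm : 0 < x m j₀)
    (hm0 : u m j₀ = 0) : ∃ J : Finset G, j₀ ∈ J ∧
    ∀ l, (∃ j ∈ J, u l j = 1) → 1 ≤ ∑ j ∈ J, u l j * x l j := by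
  classical
  have hP := hx.point
  have hg : ∀ k, 0 < utility (u k) (x k) - c k := fun k => sub_pos.2 (hP.gain k)
  -- the goods of which some rate can be made available for free
  let R : G → Prop := fun j => ∃ d, IsDirection x 0 (fun b => if b = j then -1 else 0) d ∧
    0 ≤ slope u c x d
  have hR₀ : R j₀ := by
    have hd := (isDirection_zero x).transfer (a := -1) (Or.inl hm.ne')
    refine ⟨_, ⟨hd.sign, fun k hk => (hd.row k hk).trans ?_,
      fun b hb => (hd.col b hb).trans (by simp)⟩, by simp [slope_transfer, slope_zero, hm0]⟩
    simp only [Pi.zero_apply]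
    split_ifs <;> norm_num
  -- Taking `j` earns `l` the rate `1 / g l`, writing `g l` for her level. Unless she is full of
  -- liked goods this is a net profit; giving up a liked `b` cancels it exactly and frees `b`.
  have hstep : ∀ j, R j → ∀ l, u l j = 1 →
      ∑ b, x l b = 1 ∧ ∀ b, x l b ≠ 0 → u l b = 1 ∧ R b := by
    rintro j ⟨d, hd, hs⟩ l hlj
    have hd1 := hd.transfer (a := 1) (k := l) (j := j) (Or.inr zero_le_one)
    have hpos := one_div_pos.2 (hg l)
    have hs1 := slope_transfer u c x d 1 l j
    rw [hlj, mul_one] at hs1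
    refine ⟨?_, fun b hb => ?_⟩
    · by_contra hrow
      have := hx.slope_nonpos (r := 0) (s := 0) (d := transfer d 1 l j)
        ⟨hd1.sign, fun k hk => (hd1.row k hk).trans ?_,
          fun b hb => (hd1.col b hb).trans (by by_cases h : b = j <;> simp [h])⟩
        (fun _ => le_rfl) fun _ => le_rfl
      · linarith
      · have : k ≠ l := by rintro rfl; exact hrow hk
        simp [this]
    · have hd2 := hd1.transfer (a := -1) (Or.inl hb)
      have hd3 : IsDirection x 0 (fun a => if a = b then -1 else 0)
          (transfer (transfer d 1 l j) (-1) l b) :=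
        ⟨hd2.sign, fun a ha => (hd2.row a ha).trans (by by_cases h : a = l <;> simp [h]),
          fun a ha => (hd2.col a ha).trans (by by_cases h : a = j <;> simp [h])⟩
      have hs3 := slope_transfer u c x (transfer d 1 l j) (-1) l b
      rcases hu l b with h0 | h1
      · have := hx.slope_nonpos hd3 (fun _ => le_rfl) fun a => by split_ifs <;> norm_num
        rw [hs3, h0] at this
        simp only [zero_mul, zero_div, add_zero] at this
        linarith
      · refine ⟨h1, _, hd3, ?_⟩
        rw [hs3, h1, one_mul, neg_div]
        linarith
  refine ⟨Finset.univ.filter R, by simpa using hR₀, fun l ⟨j, hj, hlj⟩ => ?_⟩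
  obtain ⟨hsum, hto⟩ := hstep j (by simpa using hj) l hlj
  rw [← hsum, ← Finset.sum_subset (Finset.subset_univ (Finset.univ.filter R)) fun b _ hb => by
    by_contra h0
    exact hb (by simpa using (hto b h0).2)]
  refine Finset.sum_le_sum fun b _ => ?_
  by_cases h0 : x l b = 0
  · simp [h0]
  · rw [(hto b h0).1, one_mul]

lemma IsNashSolution.isBalanced {u : A → G → ℝ} (hu : ∀ k, Dichotomous (u k)) {c : A → ℝ}
    {x : A → G → ℝ} (hx : IsNashSolution u c x) : IsBalanced u c x :=
  ⟨hx.point.nonneg, hx.point.row, hx.point.col, fun _ hl => hx.exists_bottleneck hu hl,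
    fun _ _ hm hm0 => hx.exists_filler hu hm hm0⟩

end OneDLAD

theorem mainTheorem9 {A G : Type*} [Fintype A] [Fintype G] [DecidableEq A] [DecidableEq G]
    (hcard : Fintype.card A = Fintype.card G)
    (u : A → G → ℝ) (hu : ∀ k, OneDLAD.Dichotomous (u k))
    (c : A → ℝ) (hc : ∀ k, 0 ≤ c k)
    (hfeas : OneDLAD.IsFeasible u c)
    (i : A) (r : G → ℝ) (hr : OneDLAD.Dichotomous r) :
    (∀ (x : A → G → ℝ) (p : G → ℝ) (q : A → ℝ) (x' : A → G → ℝ) (p' : G → ℝ) (q' : A → ℝ),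
      OneDLAD.IsOutput u c x p q →
      OneDLAD.IsOutput (Function.update u i r) c x' p' q' →
      OneDLAD.utility (u i) (x' i) ≤ OneDLAD.utility (u i) (x i)) ∧
    (∀ x x' : A → G → ℝ,
      OneDLAD.IsNashSolution u c x →
      OneDLAD.IsNashSolution (Function.update u i r) c x' →
      OneDLAD.utility (u i) (x' i) ≤ OneDLAD.utility (u i) (x i)) := by
  have hu' := OneDLAD.dichotomous_update hu i hr
  exact ⟨fun x p q x' p' q' hx hx' =>
      OneDLAD.utility_le_of_isBalanced hu hr (hx.isBalanced hu hc) (hx'.isBalanced hu' hc),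
    fun x x' hx hx' =>
      OneDLAD.utility_le_of_isBalanced hu hr (hx.isBalanced hu) (hx'.isBalanced hu')⟩
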